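/- Let $\mathcal C$ be a cocomplete closed symmetric monoidal category with tensor product $\otimes$, unit $\mathbf 1$ and inner hom $\hom$, whose underlying category is a model category. Let $R:\mathcal C\to\mathcal C$ be a symmetric monoidal fibrant replacement functor, that is: $R$ is a (lax) symmetric monoidal functor with structure morphisms $\varepsilon:\mathbf 1\to R\mathbf 1$ and $\mu_{X,Y}: RX\otimes RY\to R(X\otimes Y)$, equipped with a natural transformation $\eta:\mathrm{id}\Rightarrow R$ such that every $\eta_X: X\to RX$ is a weak equivalence, every $RX$ is fibrant, and $\eta$ is monoidal, i.e. $\mu_{X,Y}\circ(\eta_X\otimes\eta_Y)=\eta_{X\otimes Y}$ for all $X,Y$, and $\eta_{\mathbf 1}=\varepsilon$. For every $X$ let $r_X:\hom(X,X)\to\hom(RX,RX)$ be the morphism adjoint to $$\hom(X,X)\otimes RX\xrightarrow{\eta\otimes \mathrm{id}}R\hom(X,X)\otimes RX\xrightarrow{\mu}R(\hom(X,X)\otimes X)\xrightarrow{R(\mathrm{ev})}RX .$$ Let $\mathcal O$ be an operad in $\mathcal C$ and $A$ an $\mathcal O$-algebra. An $A$-module is an object $M$ with a unital, equivariant and associative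 family of morphisms $\mathcal O(n+1)\otimes A^{\otimes n}\otimes M\to M$, $n\ge 0$. Let $U(A)$ be the universal enveloping algebra of $A$, i.e. the largest quotient of $\coprod_{n\ge0}\mathcal O(n+1)\otimes_{\mathfrak S_n}A^{\otimes n}$ in which, for all $n$ and $m_1,\dots,m_n$, the two morphisms out of $\mathcal O(n+1)\otimes\bigotimes_{i=1}^n(\mathcal O(m_i)\otimes A^{\otimes m_i})$ become equal that are given by letting each $\mathcal O(m_i)$ act on $A^{\otimes m_i}$, and by operadic composition (with the operadic unit in the last slot). The action on an $A$-module $M$ corresponds by adjunction to a morphism $a_M:U(A)\to\hom(M,M)$. Call a morphism of $A$-modules a weak equivalence (respectively a fibration) if its underlying morphism in $\mathcal C$ is one. Then for every $A$-module $M$ there is exactly one $A$-module structure on $RM$ whose associated morphism $U(A)\to\hom(RM,RM)$ is the composite $$U(A)\xrightarrow{a_M}\hom(M,M)\xrightarrow{r_M}\hom(RM,RM).$$ With these structures, $Rf$ is a morphism of $A$-modules for every morphism $f$ of $A$-modules, and $\eta_M:M\to RM$ is a morphism of $A$-modules for every $A$-module $M$; so $R$ induces an endofunctor of the category of $A$-modules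 and $\eta$ a natural transformation from the identity to it. This endofunctor is a fibrant replacement functor on the category of $A$-modules with the weak equivalences and fibrations above: every $\eta_M: M\to RM$ is a weak equivalence of $A$-modules, and for every $A$-module $M$ the morphism from $RM$ to the terminal $A$-module is a fibration. In particular it is a fibrant replacement functor for every model structure on the category of $A$-modules with these weak equivalences and fibrations. -/

import Mathlib

open CategoryTheory CategoryTheory.Limits MonoidalCategory HomotopicalAlgebra

universe v u

noncomputable section

namespace OperadModules

/-! ### Block bookkeeping: finite sums of natural numbers and positions inside blocks -/

section Blocks

/-- The sum `m 0 + ... + m (n - 1)`. -/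
def tot : {n : ℕ} → (Fin n → ℕ) → ℕ
  | 0, _ => 0
  | n + 1, m => tot (fun i : Fin n => m i.castSucc) + m (Fin.last n)

theorem tot_eq_sum : ∀ {n : ℕ} (m : Fin n → ℕ), tot m = ∑ i, m i
  | 0, _ => rfl
  | n + 1, m => by rw [tot, tot_eq_sum, Fin.sum_univ_castSucc]

theorem tot_one (n : ℕ) : tot (fun _ : Fin n => 1) = n := by
  simp [tot_eq_sum]

theorem tot_single (k : ℕ) : tot (fun _ : Fin 1 => k) = k := by
  simp [tot_eq_sum]

theorem tot_comp {n : ℕ} (σ : Equiv.Perm (Fin n)) (m : Fin n → ℕ) :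
    tot (fun i => m (σ i)) = tot m := by
  rw [tot_eq_sum, tot_eq_sum]
  exact Equiv.sum_comp σ m

theorem tot_snoc {n : ℕ} (m : Fin n → ℕ) (k : ℕ) :
    tot (Fin.snoc m k : Fin (n + 1) → ℕ) = tot m + k := by
  simp [tot]

theorem emb_lt : ∀ {n : ℕ} (m : Fin n → ℕ) (i : Fin n) (j : Fin (m i)),
    tot (fun a : Fin i.val => m ⟨a, a.2.trans i.2⟩) + j.val < tot m
  | 0, _, i, _ => i.elim0
  | n + 1, m, i, j => by
    induction i using Fin.lastCases with
    | last => exact Nat.add_lt_add_left j.2 _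
    | cast i =>
      exact lt_of_lt_of_le (emb_lt (fun i : Fin n => m i.castSucc) i j) (Nat.le_add_right _ _)

/-- Position `j` of the `i`-th block, among `tot m` positions cut into consecutive blocks of
sizes `m 0, m 1, ...`. -/
def emb {n : ℕ} (m : Fin n → ℕ) (i : Fin n) (j : Fin (m i)) : Fin (tot m) :=
  ⟨tot (fun a : Fin i.val => m ⟨a, a.2.trans i.2⟩) + j.val, emb_lt m i j⟩

/-- The bijection `(i, j) ↦ emb m i j`. -/
def embEquiv {n : ℕ} (m : Fin n → ℕ) : (Σ i, Fin (m i)) ≃ Fin (tot m) :=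
  finSigmaFinEquiv.trans (finCongr (tot_eq_sum m).symm)

theorem embEquiv_apply {n : ℕ} (m : Fin n → ℕ) (i : Fin n) (j : Fin (m i)) :
    embEquiv m ⟨i, j⟩ = emb m i j := by
  apply Fin.ext
  simp only [embEquiv, emb, Equiv.trans_apply, finCongr_apply, Fin.val_cast,
    finSigmaFinEquiv_apply, tot_eq_sum]
  rfl

theorem tot_add : ∀ {a : ℕ} (b : ℕ) (l : Fin (a + b) → ℕ),
    tot l = tot (fun i => l (Fin.castAdd b i)) + tot (fun j => l (Fin.natAdd a j))
  | _, 0, _ => rfl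
  | a, b + 1, l => by
    change tot (fun i : Fin (a + b) => l i.castSucc) + _ = _ + (_ + _)
    rw [tot_add b, ← Nat.add_assoc]
    rfl

theorem tot_tot : ∀ {n : ℕ} (m : Fin n → ℕ) (l : Fin (tot m) → ℕ),
    tot (fun i => tot (fun j => l (emb m i j))) = tot l
  | 0, _, _ => rfl
  | n + 1, m, l => by
    refine Eq.trans ?_ (tot_add (m (Fin.last n)) l).symm
    rw [← tot_tot (fun i : Fin n => m i.castSucc)
      (fun p => l (Fin.castAdd (m (Fin.last n)) p))]
    rfl

/-- The block permutation: block `j` of the sequence of blocks `m (σ 0), m (σ 1), ...` is sent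
identically onto block `σ j` of the sequence of blocks `m 0, m 1, ...`. -/
def blockPerm {n : ℕ} (σ : Equiv.Perm (Fin n)) (m : Fin n → ℕ) : Equiv.Perm (Fin (tot m)) :=
  ((finCongr (tot_comp σ m).symm).trans (embEquiv (fun i => m (σ i))).symm).trans
    ((Equiv.sigmaCongrLeft (β := fun i => Fin (m i)) σ).trans (embEquiv m))

/-- The sum of permutations `τ 0 + ... + τ (n - 1)`, acting blockwise. -/
def sumPerm {n : ℕ} (m : Fin n → ℕ) (τ : ∀ i, Equiv.Perm (Fin (m i))) :
    Equiv.Perm (Fin (tot m)) :=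
  (embEquiv m).permCongr (Equiv.sigmaCongrRight τ)

/-- The permutation `σ + id` of `n + 1` letters fixing the last letter. -/
def addId {n : ℕ} (σ : Equiv.Perm (Fin n)) : Equiv.Perm (Fin (n + 1)) :=
  finSumFinEquiv.permCongr (Equiv.sumCongr σ (Equiv.refl (Fin 1)))

/-- What remains of a permutation `σ` of `n + 1` letters after the last letter and its image
have been deleted. -/
def tailPerm {n : ℕ} (σ : Equiv.Perm (Fin (n + 1))) : Equiv.Perm (Fin n) :=
  Equiv.removeNone (((finSuccEquiv' (Fin.last n)).symm.trans σ).trans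
    (finSuccEquiv' (σ (Fin.last n))))

theorem tailPerm_spec {n : ℕ} (σ : Equiv.Perm (Fin (n + 1))) (j : Fin n) :
    (σ (Fin.last n)).succAbove (tailPerm σ j) = σ j.castSucc := by
  have hne : σ j.castSucc ≠ σ (Fin.last n) := fun h =>
    (Fin.castSucc_lt_last j).ne (σ.injective h)
  obtain ⟨k, hk⟩ := Fin.exists_succAbove_eq hne
  have h1 : (((finSuccEquiv' (Fin.last n)).symm.trans σ).trans
      (finSuccEquiv' (σ (Fin.last n)))) (some j) = some k := by
    simp [← hk]
  have h2 := Equiv.removeNone_some _ ⟨k, h1⟩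
  rw [h1] at h2
  have h3 : tailPerm σ j = k := Option.some_injective _ h2
  rw [h3, hk]

end Blocks

/-! ### Iterated tensor products in a symmetric monoidal category -/

section Tensor

variable {C : Type u} [Category.{v} C] [MonoidalCategory C]

/-- `X 0 ⊗ ... ⊗ X (n - 1)`, bracketed from the left; the unit object for `n = 0`. -/
def tensorFin : {n : ℕ} → (Fin n → C) → C
  | 0, _ => 𝟙_ C
  | n + 1, X => tensorFin (fun i : Fin n => X i.castSucc) ⊗ X (Fin.last n)

/-- The tensor power `X^{⊗ n}`. -/
abbrev tpow (X : C) (n : ℕ) : C := tensorFin (fun _ : Fin n => X)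

/-- `f 0 ⊗ ... ⊗ f (n - 1)`. -/
def tensorMap : {n : ℕ} → {X Y : Fin n → C} → (∀ i, X i ⟶ Y i) → (tensorFin X ⟶ tensorFin Y)
  | 0, _, _, _ => 𝟙 (𝟙_ C)
  | n + 1, _, _, f => tensorMap (fun i : Fin n => f i.castSucc) ⊗ₘ f (Fin.last n)

/-- The `n`-th power `𝟙 ⟶ X^{⊗ n}` of a morphism `𝟙 ⟶ X`. -/
def unitPow {X : C} (e : 𝟙_ C ⟶ X) : (n : ℕ) → (𝟙_ C ⟶ tpow X n)
  | 0 => 𝟙 (𝟙_ C)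
  | n + 1 => (λ_ (𝟙_ C)).inv ≫ (unitPow e n ⊗ₘ e)

/-- Juxtaposition: removing the brackets in
`(Z 0 ⊗ ... ⊗ Z (a - 1)) ⊗ (Z a ⊗ ... ⊗ Z (a + b - 1))`. -/
def appendHom {a : ℕ} : (b : ℕ) → (Z : Fin (a + b) → C) →
    (tensorFin (fun i : Fin a => Z (Fin.castAdd b i)) ⊗
      tensorFin (fun j : Fin b => Z (Fin.natAdd a j)) ⟶ tensorFin Z)
  | 0, _ => (ρ_ _).hom
  | b + 1, Z => (α_ _ _ _).inv ≫
      (appendHom b (fun p : Fin (a + b) => Z p.castSucc) ▷ Z (Fin.last (a + b)))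

/-- Removing the brackets in an iterated tensor product of iterated tensor products. -/
def flattenHom : {n : ℕ} → (m : Fin n → ℕ) → (Z : Fin (tot m) → C) →
    (tensorFin (fun i => tensorFin (fun j => Z (emb m i j))) ⟶ tensorFin Z)
  | 0, _, _ => 𝟙 (𝟙_ C)
  | n + 1, m, Z =>
      (flattenHom (fun i : Fin n => m i.castSucc)
        (fun p => Z (Fin.castAdd (m (Fin.last n)) p)) ▷ _) ≫ appendHom (m (Fin.last n)) Z

/-- Transport along an equality of indices. -/
def castHom (F : ℕ → C) {a b : ℕ} (h : a = b) : F a ⟶ F b := eqToHom (congrArg F h)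

variable [BraidedCategory C]

/-- The canonical shuffle
`(X 0 ⊗ Y 0) ⊗ ... ⊗ (X (n-1) ⊗ Y (n-1)) ⟶ (X 0 ⊗ ... ⊗ X (n-1)) ⊗ (Y 0 ⊗ ... ⊗ Y (n-1))`. -/
def unzip : {n : ℕ} → (X Y : Fin n → C) →
    (tensorFin (fun i => X i ⊗ Y i) ⟶ tensorFin X ⊗ tensorFin Y)
  | 0, _, _ => (λ_ (𝟙_ C)).inv
  | n + 1, X, Y =>
      (unzip (fun i : Fin n => X i.castSucc) (fun i : Fin n => Y i.castSucc) ▷ _) ≫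
        tensorμ _ _ _ _

/-- Moving the `i`-th tensor factor to the last position. -/
def pull : {n : ℕ} → (X : Fin (n + 1) → C) → (i : Fin (n + 1)) →
    (tensorFin X ⟶ tensorFin (fun j : Fin n => X (i.succAbove j)) ⊗ X i)
  | 0, X, i => 𝟙_ C ◁ eqToHom (congrArg X (Subsingleton.elim (α := Fin 1) _ i))
  | n + 1, X, i =>
    if h : i = Fin.last (n + 1) then
      tensorMap (fun j => eqToHom (by rw [h, Fin.succAbove_last])) ⊗ₘ eqToHom (by rw [h])
    else
      (pull (fun j : Fin (n + 1) => X j.castSucc) (i.castPred h) ▷ X (Fin.last (n + 1))) ≫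
        (α_ _ _ _).hom ≫ (_ ◁ (β_ _ _).hom) ≫ (α_ _ _ _).inv ≫
        ((tensorMap (fun j => eqToHom (by
              rw [← Fin.castSucc_succAbove_castSucc, Fin.castSucc_castPred])) ⊗ₘ
            eqToHom (congrArg X (Fin.succAbove_ne_last_last h).symm)) ⊗ₘ
          eqToHom (by rw [Fin.castSucc_castPred]))

/-- The canonical symmetry `x 0 ⊗ ... ⊗ x (n-1) ↦ x (σ 0) ⊗ ... ⊗ x (σ (n-1))`. -/
def permHom : {n : ℕ} → (σ : Equiv.Perm (Fin n)) → (X : Fin n → C) →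
    (tensorFin X ⟶ tensorFin (fun i => X (σ i)))
  | 0, _, _ => 𝟙 (𝟙_ C)
  | n + 1, σ, X =>
      pull X (σ (Fin.last n)) ≫
        ((permHom (tailPerm σ) (fun j => X ((σ (Fin.last n)).succAbove j)) ≫
          tensorMap (fun j => eqToHom (by rw [tailPerm_spec]))) ▷ X (σ (Fin.last n)))

end Tensor

/-! ### Operads and their algebras -/

section Operads

/-- A (symmetric, unital) operad in a symmetric monoidal category. -/
structure Operad (C : Type u) [Category.{v} C] [MonoidalCategory C] [SymmetricCategory C] where
  /-- the underlying sequence of objects -/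
  obj : ℕ → C
  /-- the right action of the symmetric groups -/
  act : ∀ {n : ℕ}, Equiv.Perm (Fin n) → (obj n ⟶ obj n)
  act_one : ∀ n : ℕ, act (1 : Equiv.Perm (Fin n)) = 𝟙 (obj n)
  act_mul : ∀ {n : ℕ} (σ τ : Equiv.Perm (Fin n)), act (σ * τ) = act σ ≫ act τ
  /-- the operadic composition law -/
  comp : ∀ {n : ℕ} (m : Fin n → ℕ), obj n ⊗ tensorFin (fun i => obj (m i)) ⟶ obj (tot m)
  /-- the unit -/
  unit : 𝟙_ C ⟶ obj 1
  assoc : ∀ {n : ℕ} (m : Fin n → ℕ) (l : Fin (tot m) → ℕ),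
    (obj n ◁ tensorMap (fun i => comp (fun j => l (emb m i j)))) ≫
        comp (fun i => tot (fun j => l (emb m i j))) ≫ castHom obj (tot_tot m l) =
      (obj n ◁ unzip (fun i => obj (m i)) (fun i => tensorFin (fun j => obj (l (emb m i j))))) ≫
        (α_ _ _ _).inv ≫ (comp m ⊗ₘ flattenHom m (fun p => obj (l p))) ≫ comp l
  equivariant_outer : ∀ {n : ℕ} (σ : Equiv.Perm (Fin n)) (m : Fin n → ℕ),
    (act σ ⊗ₘ permHom σ (fun i => obj (m i))) ≫ comp (fun i => m (σ i)) ≫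
        castHom obj (tot_comp σ m) =
      comp m ≫ act (blockPerm σ m)
  equivariant_inner : ∀ {n : ℕ} (m : Fin n → ℕ) (τ : ∀ i, Equiv.Perm (Fin (m i))),
    (obj n ◁ tensorMap (fun i => act (τ i))) ≫ comp m = comp m ≫ act (sumPerm m τ)
  comp_unit : ∀ n : ℕ,
    (ρ_ (obj n)).inv ≫ (obj n ◁ unitPow unit n) ≫ comp (fun _ : Fin n => 1) ≫
      castHom obj (tot_one n) = 𝟙 (obj n)
  unit_comp : ∀ k : ℕ,
    (λ_ (obj k)).inv ≫ (unit ⊗ₘ (λ_ (obj k)).inv) ≫ comp (fun _ : Fin 1 => k) ≫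
      castHom obj (tot_single k) = 𝟙 (obj k)

variable {C : Type u} [Category.{v} C] [MonoidalCategory C] [SymmetricCategory C]

/-- An algebra over an operad. -/
structure OpAlgebra (O : Operad C) where
  /-- the underlying object -/
  X : C
  /-- the multiplication law -/
  act : ∀ n : ℕ, O.obj n ⊗ tpow X n ⟶ X
  assoc : ∀ {n : ℕ} (m : Fin n → ℕ),
    (O.obj n ◁ tensorMap (fun i => act (m i))) ≫ act n =
      (O.obj n ◁ unzip (fun i => O.obj (m i)) (fun i => tpow X (m i))) ≫
        (α_ _ _ _).inv ≫ (O.comp m ⊗ₘ flattenHom m (fun _ => X)) ≫ act (tot m)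
  equivariant : ∀ {n : ℕ} (σ : Equiv.Perm (Fin n)),
    (O.act σ ⊗ₘ permHom σ (fun _ : Fin n => X)) ≫ act n = act n
  unital : (λ_ X).inv ≫ (O.unit ⊗ₘ (λ_ X).inv) ≫ act 1 = 𝟙 X

variable {O : Operad C} (A : OpAlgebra O)

/-! ### Modules over an algebra -/

/-- `O(n + 1) ⊗ A^{⊗ n}`. -/
abbrev opr (n : ℕ) : C := O.obj (n + 1) ⊗ tpow A.X n

/-- `O(n + 1) ⊗ ⨂ i, (O(m i) ⊗ A^{⊗ m i})`. -/
abbrev opr₂ {n : ℕ} (m : Fin n → ℕ) : C :=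
  O.obj (n + 1) ⊗ tensorFin (fun i => O.obj (m i) ⊗ tpow A.X (m i))

/-- The map `opr₂ A m ⟶ opr A n` letting the inner operations act on `A`. -/
def evalInner {n : ℕ} (m : Fin n → ℕ) : opr₂ A m ⟶ opr A n :=
  O.obj (n + 1) ◁ tensorMap (fun i => A.act (m i))

/-- The composite
`O(n+1) ⊗ O(m 0) ⊗ ... ⊗ O(m (n-1)) ⊗ O(q+1) ⟶ O(m 0 + ... + m (n-1) + q + 1)`, written
on the source `(O(n+1) ⊗ ⨂ i, O(m i)) ⊗ O(q+1)`. -/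
def compLast (O : Operad C) {n : ℕ} (m : Fin n → ℕ) (q : ℕ) :
    (O.obj (n + 1) ⊗ tensorFin (fun i => O.obj (m i))) ⊗ O.obj (q + 1) ⟶
      O.obj (tot m + q + 1) :=
  (α_ _ _ _).hom ≫
    (O.obj (n + 1) ◁
      (tensorMap (fun i => castHom O.obj (Fin.snoc_castSucc (α := fun _ => ℕ) (q + 1) m i).symm) ⊗ₘ
        castHom O.obj (Fin.snoc_last (α := fun _ => ℕ) (q + 1) m).symm)) ≫
    O.comp (Fin.snoc m (q + 1) : Fin (n + 1) → ℕ) ≫ castHom O.obj (tot_snoc m (q + 1))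

/-- Composing operations in the operad, the last slot being the module slot, and collecting the
arguments from `A`. -/
def collapse {n : ℕ} (m : Fin n → ℕ) (q : ℕ) :
    opr₂ A m ⊗ opr A q ⟶ opr A (tot m + q) :=
  (((O.obj (n + 1) ◁ unzip (fun i => O.obj (m i)) (fun i => tpow A.X (m i))) ≫
      (α_ _ _ _).inv) ▷ opr A q) ≫
    tensorμ _ _ _ _ ≫
    (compLast O m q ⊗ₘ
      ((flattenHom m (fun _ => A.X) ▷ tpow A.X q) ≫ appendHom q (fun _ => A.X)))

/-- The unit `𝟙 ⟶ O(1) ⊗ A^{⊗ 0}`. -/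
def oprUnit : 𝟙_ C ⟶ opr A 0 := O.unit ≫ (ρ_ (O.obj 1)).inv

/-- The action of `σ` on `O(n + 1) ⊗ A^{⊗ n}`. -/
def oprPerm {n : ℕ} (σ : Equiv.Perm (Fin n)) : opr A n ⟶ opr A n :=
  O.act (addId σ) ⊗ₘ permHom σ (fun _ : Fin n => A.X)

/-- A structure of an `A`-module on an object `M`: a unital, equivariant and associative
`A`-operation on `M`. -/
structure ModStr (M : C) where
  /-- the `A`-operation -/
  act : ∀ n : ℕ, opr A n ⊗ M ⟶ M
  assoc : ∀ {n : ℕ} (m : Fin n → ℕ) (q : ℕ),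
    (evalInner A m ⊗ₘ act q) ≫ act n =
      (α_ _ _ _).inv ≫ (collapse A m q ▷ M) ≫ act (tot m + q)
  equivariant : ∀ {n : ℕ} (σ : Equiv.Perm (Fin n)), (oprPerm A σ ▷ M) ≫ act n = act n
  unital : (λ_ M).inv ≫ (oprUnit A ▷ M) ≫ act 0 = 𝟙 M

/-- Acting on `A` and composing in the operad agree on every module. -/
theorem ModStr.relation {A : OpAlgebra O} {M : C} (s : ModStr A M) {n : ℕ} (m : Fin n → ℕ) :
    (evalInner A m ▷ M) ≫ s.act n =
      (((ρ_ _).inv ≫ (opr₂ A m ◁ oprUnit A) ≫ collapse A m 0) ▷ M) ≫ s.act (tot m + 0) := by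
  have h1 : evalInner A m ▷ M =
      (opr₂ A m ◁ ((λ_ M).inv ≫ (oprUnit A ▷ M))) ≫ (evalInner A m ⊗ₘ s.act 0) := by
    rw [MonoidalCategory.tensorHom_def', ← Category.assoc,
      ← MonoidalCategory.whiskerLeft_comp, Category.assoc, s.unital,
      MonoidalCategory.whiskerLeft_id, Category.id_comp]
  have h2 : (opr₂ A m ◁ ((λ_ M).inv ≫ (oprUnit A ▷ M))) ≫ (α_ _ _ _).inv =
      ((ρ_ _).inv ≫ (opr₂ A m ◁ oprUnit A)) ▷ M := by
    monoidal
  rw [h1, Category.assoc, s.assoc m 0, ← Category.assoc, h2, ← Category.assoc,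
    ← MonoidalCategory.comp_whiskerRight, Category.assoc]

variable {A} in
/-- Compatibility of a morphism with `A`-module structures. -/
def IsModHom {M N : C} (s : ModStr A M) (t : ModStr A N) (f : M ⟶ N) : Prop :=
  ∀ n : ℕ, s.act n ≫ f = (opr A n ◁ f) ≫ t.act n

/-- Modules over the algebra `A`. -/
structure AMod where
  /-- the underlying object -/
  X : C
  /-- the module structure -/
  str : ModStr A X

variable {A} in
/-- Morphisms of `A`-modules. -/
@[ext]
structure AMod.Hom (M N : AMod A) where
  /-- the underlying morphism -/
  hom : M.X ⟶ N.X
  isModHom : IsModHom M.str N.str hom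

instance : Category (AMod A) where
  Hom M N := AMod.Hom M N
  id M := ⟨𝟙 M.X, fun n => by simp⟩
  comp f g := ⟨f.hom ≫ g.hom, fun n => by
    rw [← Category.assoc, f.isModHom n, Category.assoc, g.isModHom n,
      MonoidalCategory.whiskerLeft_comp, Category.assoc]⟩
  id_comp f := AMod.Hom.ext (Category.id_comp f.hom)
  comp_id f := AMod.Hom.ext (Category.comp_id f.hom)
  assoc f g h := AMod.Hom.ext (Category.assoc f.hom g.hom h.hom)

/-- The forgetful functor from `A`-modules to the base category. -/
def forgetMod : AMod A ⥤ C where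
  obj M := M.X
  map f := f.hom

variable {A} in
/-- Assigning to every `A`-module `M` an `A`-module structure on `R M`, such that `R` sends
morphisms of `A`-modules to morphisms of `A`-modules, is an endofunctor of the category of
`A`-modules. -/
def liftFunctor (R : C ⥤ C) (s : ∀ M : AMod A, ModStr A (R.obj M.X))
    (hs : ∀ (M N : AMod A) (f : M ⟶ N), IsModHom (s M) (s N) (R.map f.hom)) :
    AMod A ⥤ AMod A where
  obj M := ⟨R.obj M.X, s M⟩
  map {M N} f := ⟨R.map f.hom, hs M N f⟩
  map_id M := AMod.Hom.ext (R.map_id M.X)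
  map_comp f g := AMod.Hom.ext (R.map_comp f.hom g.hom)

variable {A} in
/-- A natural transformation `η : 𝟭 ⟶ R` whose components at `A`-modules are morphisms of
`A`-modules, as a natural transformation of endofunctors of the category of `A`-modules. -/
def liftNatTrans {R : C ⥤ C} (η : 𝟭 C ⟶ R) (s : ∀ M : AMod A, ModStr A (R.obj M.X))
    (hs : ∀ (M N : AMod A) (f : M ⟶ N), IsModHom (s M) (s N) (R.map f.hom))
    (hη : ∀ M : AMod A, IsModHom M.str (s M) (η.app M.X)) :
    𝟭 (AMod A) ⟶ liftFunctor R s hs where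
  app M := ⟨η.app M.X, hη M⟩
  naturality _ _ f := AMod.Hom.ext (η.naturality f.hom)

/-- The terminal object of the base category, as an `A`-module. -/
def terminalMod [HasTerminal C] : AMod A where
  X := ⊤_ C
  str :=
    { act := fun _ => terminal.from _
      assoc := fun _ _ => Subsingleton.elim _ _
      equivariant := fun _ => Subsingleton.elim _ _
      unital := Subsingleton.elim _ _ }

instance [HasTerminal C] : HasTerminal (AMod A) :=
  IsTerminal.hasTerminal (X := terminalMod A)
    (IsTerminal.ofUniqueHom
      (fun M => (⟨(terminal.from M.X : M.X ⟶ ⊤_ C), fun _ =>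
        Subsingleton.elim (α := (_ ⟶ ⊤_ C)) _ _⟩ : AMod.Hom M (terminalMod A)))
      (fun _ _ => AMod.Hom.ext (Subsingleton.elim (α := (_ ⟶ ⊤_ C)) _ _)))

end Operads

/-! ### The universal enveloping algebra -/

section Enveloping

variable {C : Type u} [Category.{v} C] [MonoidalCategory C] [SymmetricCategory C]
  {O : Operad C}

/-- The morphism `O(n + 1) ⊗ A^{⊗ n} ⟶ hom(M, M)` adjoint to the action. -/
def ModStr.curryAct {A : OpAlgebra O} [MonoidalClosed C] {M : C} (s : ModStr A M) (n : ℕ) : opr A n ⟶ (ihom M).obj M :=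
  MonoidalClosed.curry ((β_ M (opr A n)).hom ≫ s.act n)

theorem ModStr.comp_curryAct {A : OpAlgebra O} [MonoidalClosed C] {M : C} (s : ModStr A M) (n : ℕ) {Y : C} (f : Y ⟶ opr A n) :
    f ≫ s.curryAct n = MonoidalClosed.curry ((β_ M Y).hom ≫ (f ▷ M) ≫ s.act n) := by
  rw [curryAct, ← MonoidalClosed.curry_natural_left,
    BraidedCategory.braiding_naturality_right_assoc]

variable (A : OpAlgebra O) [HasColimits C]

/-- `O(n + 1) ⊗_{S_n} A^{⊗ n}`: the coinvariants of `O(n + 1) ⊗ A^{⊗ n}` under `S_n`. -/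
abbrev coinv (n : ℕ) : C :=
  coequalizer (Sigma.desc (fun σ : Equiv.Perm (Fin n) => oprPerm A σ))
    (Sigma.desc (fun _ : Equiv.Perm (Fin n) => 𝟙 (opr A n)))

/-- The tensor algebra `T(A) = ∐ n, O(n + 1) ⊗_{S_n} A^{⊗ n}`. -/
abbrev tensorAlg : C := ∐ (fun n : ℕ => coinv A n)

/-- The canonical morphism `O(n + 1) ⊗ A^{⊗ n} ⟶ T(A)`. -/
def toTensorAlg (n : ℕ) : opr A n ⟶ tensorAlg A :=
  coequalizer.π _ _ ≫ Sigma.ι (fun n : ℕ => coinv A n) n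

/-- The source of the relations defining the universal enveloping algebra. -/
abbrev relSource : C := ∐ (fun r : Σ n : ℕ, (Fin n → ℕ) => opr₂ A r.2)

/-- Letting the inner operations act on `A`. -/
def relEval : relSource A ⟶ tensorAlg A :=
  Sigma.desc (fun r => evalInner A r.2 ≫ toTensorAlg A r.1)

/-- Composing the inner operations with the outer one in the operad, the unit of the operad
being inserted in the last slot. -/
def relComp : relSource A ⟶ tensorAlg A :=
  Sigma.desc (fun r => (ρ_ _).inv ≫ (opr₂ A r.2 ◁ oprUnit A) ≫ collapse A r.2 0 ≫
    toTensorAlg A (tot r.2 + 0))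

/-- (The underlying object of) the universal enveloping algebra `U(A)`: the largest quotient of
`T(A)` in which acting on `A` and composing in the operad agree. -/
abbrev envAlg : C := coequalizer (relEval A) (relComp A)

/-- The canonical morphism `O(n + 1) ⊗ A^{⊗ n} ⟶ U(A)`. -/
def toEnvAlg (n : ℕ) : opr A n ⟶ envAlg A :=
  toTensorAlg A n ≫ coequalizer.π (relEval A) (relComp A)

variable {A} [MonoidalClosed C]

/-- The morphism `T(A) ⟶ hom(M, M)` defined by an `A`-module `M`. -/
def ModStr.tensorAlgMap {M : C} (s : ModStr A M) : tensorAlg A ⟶ (ihom M).obj M :=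
  Sigma.desc (fun n => coequalizer.desc (s.curryAct n) (by
    apply Sigma.hom_ext
    intro σ
    rw [Sigma.ι_desc_assoc, Sigma.ι_desc_assoc, s.comp_curryAct, s.equivariant,
      Category.id_comp, ModStr.curryAct]))

theorem ModStr.toTensorAlg_map {M : C} (s : ModStr A M) (n : ℕ) :
    toTensorAlg A n ≫ s.tensorAlgMap = s.curryAct n := by
  rw [toTensorAlg, tensorAlgMap, Category.assoc, Sigma.ι_desc, coequalizer.π_desc]

/-- The morphism `U(A) ⟶ hom(M, M)` defined by an `A`-module `M`. -/
def ModStr.envMap {M : C} (s : ModStr A M) : envAlg A ⟶ (ihom M).obj M :=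
  coequalizer.desc s.tensorAlgMap (by
    apply Sigma.hom_ext
    rintro ⟨n, m⟩
    rw [relEval, relComp, Sigma.ι_desc_assoc, Sigma.ι_desc_assoc, Category.assoc,
      s.toTensorAlg_map, s.comp_curryAct, s.relation m, ← s.comp_curryAct,
      ← s.toTensorAlg_map]
    simp only [Category.assoc])

theorem ModStr.toEnvAlg_map {M : C} (s : ModStr A M) (n : ℕ) :
    toEnvAlg A n ≫ s.envMap = s.curryAct n := by
  rw [toEnvAlg, envMap, Category.assoc, coequalizer.π_desc, s.toTensorAlg_map]

/-- For a lax monoidal functor `R` with a natural transformation `η : 𝟭 ⟶ R`, the morphism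
`hom(X, X) ⟶ hom(R X, R X)` adjoint to
`R X ⊗ hom(X, X) ⟶ R X ⊗ R hom(X, X) ⟶ R (X ⊗ hom(X, X)) ⟶ R X`. -/
def endMap (R : C ⥤ C) [R.LaxMonoidal] (η : 𝟭 C ⟶ R) (X : C) :
    (ihom X).obj X ⟶ (ihom (R.obj X)).obj (R.obj X) :=
  MonoidalClosed.curry
    ((R.obj X ◁ η.app ((ihom X).obj X)) ≫ Functor.LaxMonoidal.μ R X ((ihom X).obj X) ≫
      R.map ((ihom.ev X).app X))

end Enveloping

/-! ### Fibrant replacement functors -/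

/-- For classes `W` (weak equivalences) and `F` (fibrations) of morphisms, `R` together with
`η : 𝟭 ⟶ R` is a fibrant replacement functor: each `X ⟶ R X` is a weak equivalence and each
`R X` is fibrant. -/
structure IsFibrantReplacement {D : Type*} [Category* D] [HasTerminal D]
    (W F : MorphismProperty D) (R : D ⥤ D) (η : 𝟭 D ⟶ R) : Prop where
  weakEquivalence : ∀ X : D, W (η.app X)
  fibrant : ∀ X : D, F (terminal.from (R.obj X))

/-- The weak equivalences of `A`-modules: the morphisms that are weak equivalences in the base
category. -/
def modWeakEquivalences {C : Type u} [Category.{v} C] [MonoidalCategory C] [SymmetricCategory C]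
    [CategoryWithWeakEquivalences C] {O : Operad C} (A : OpAlgebra O) :
    MorphismProperty (AMod A) :=
  (weakEquivalences C).inverseImage (forgetMod A)

/-- The fibrations of `A`-modules: the morphisms that are fibrations in the base category. -/
def modFibrations {C : Type u} [Category.{v} C] [MonoidalCategory C] [SymmetricCategory C]
    [CategoryWithFibrations C] {O : Operad C} (A : OpAlgebra O) :
    MorphismProperty (AMod A) :=
  (fibrations C).inverseImage (forgetMod A)

end OperadModules

end

open CategoryTheory CategoryTheory.Limits MonoidalCategory HomotopicalAlgebra

noncomputable section

namespace OperadModules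

/-! ### The strength of `R` and its coherence. -/

section Strength

variable {C : Type u} [Category.{v} C] [MonoidalCategory C]

/-! Applying `η` to the left factor and then `μ` gives a map `X ⊗ R M ⟶ R (X ⊗ M)`. It is natural,
and because `η` is monoidal it respects associators and left unitors (`strength_tensor`,
`strength_unit`). Hence anything that acts on `M` also acts on `R M`: apply the strength, then `R`
of the action. Each module axiom for `R M` is the image under `R` of the axiom for `M`, transported
along these coherences (`ModStr.mapStrength`). The objects `O(n+1) ⊗ A^{⊗ n}` enter only as left
factors, so `R` never has to be compared with the tensor powers of `A`.

Under currying, this action is the composite of the given one with `endMap` (`curry_endMap`,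
`ModStr.mapStrength_envMap`). It is the only such structure, since the maps from the `O(n+1) ⊗ A^{⊗
n}` to `U(A)` are jointly epimorphic and currying is injective; no multiplication on `U(A)` is
needed. The homotopical claims are then inherited from the base category. -/

/-- The strength `X ⊗ R M ⟶ R (X ⊗ M)` of a lax monoidal functor `R` with a natural
transformation `η : 𝟭 ⟶ R`. -/
def strength (R : C ⥤ C) [R.LaxMonoidal] (η : 𝟭 C ⟶ R) (X M : C) :
    X ⊗ R.obj M ⟶ R.obj (X ⊗ M) :=
  (η.app X ▷ R.obj M) ≫ Functor.LaxMonoidal.μ R X M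

variable (R : C ⥤ C) [R.LaxMonoidal] (η : 𝟭 C ⟶ R)

theorem strength_natural_left {X Y : C} (f : X ⟶ Y) (M : C) :
    (f ▷ R.obj M) ≫ strength R η Y M = strength R η X M ≫ R.map (f ▷ M) := by
  have h : f ≫ η.app Y = η.app X ≫ R.map f := η.naturality f
  rw [strength, strength, Category.assoc, ← Functor.LaxMonoidal.μ_natural_left,
    ← MonoidalCategory.comp_whiskerRight_assoc, h, MonoidalCategory.comp_whiskerRight_assoc]

theorem strength_natural_right (X : C) {M N : C} (f : M ⟶ N) :
    (X ◁ R.map f) ≫ strength R η X N = strength R η X M ≫ R.map (X ◁ f) := by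
  rw [strength, strength, Category.assoc, ← Functor.LaxMonoidal.μ_natural_right,
    whisker_exchange_assoc]

/-- This is what makes `η` a morphism of modules. -/
theorem app_strength
    (h : ∀ X Y : C, (η.app X ⊗ₘ η.app Y) ≫ Functor.LaxMonoidal.μ R X Y = η.app (X ⊗ Y))
    (X M : C) : (X ◁ η.app M) ≫ strength R η X M = η.app (X ⊗ M) := by
  rw [← h, strength, tensorHom_def', Category.assoc]
  rfl

theorem strength_tensor
    (h : ∀ X Y : C, (η.app X ⊗ₘ η.app Y) ≫ Functor.LaxMonoidal.μ R X Y = η.app (X ⊗ Y))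
    (X Y M : C) :
    strength R η (X ⊗ Y) M ≫ R.map (α_ X Y M).hom =
      (α_ X Y (R.obj M)).hom ≫ (X ◁ strength R η Y M) ≫ strength R η X (Y ⊗ M) := by
  -- Monoidality of `η` splits `η` at `X ⊗ Y` into its two components, after which associativity of
  -- `μ` applies.
  have e : η.app (X ⊗ Y) ▷ R.obj M =
      ((η.app X ⊗ₘ η.app Y) ▷ R.obj M) ≫ (Functor.LaxMonoidal.μ R X Y ▷ R.obj M) := by
    rw [← MonoidalCategory.comp_whiskerRight, h]
  rw [strength, e, Category.assoc, Category.assoc, Functor.LaxMonoidal.associativity]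
  simp only [strength, MonoidalCategory.tensorHom_def, MonoidalCategory.whiskerLeft_comp,
    MonoidalCategory.comp_whiskerRight, Category.assoc]
  -- Slides `η` at `X` past the inner `η` at `Y` and the inner `μ`.
  erw [whisker_exchange_assoc, whisker_exchange_assoc]
  simp

theorem strength_unit (h : η.app (𝟙_ C) = Functor.LaxMonoidal.ε R) (M : C) :
    strength R η (𝟙_ C) M ≫ R.map (λ_ M).hom = (λ_ (R.obj M)).hom := by
  rw [strength, h, Category.assoc, ← Functor.LaxMonoidal.left_unitality]

/-- Naturality of `η` at `curry f` replaces it by `R (curry f)`, naturality of `μ` carries that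
inside `R`, and there evaluation undoes the currying. -/
theorem curry_endMap [MonoidalClosed C] {X M : C} (f : M ⊗ X ⟶ M) :
    MonoidalClosed.curry f ≫ endMap R η M =
      MonoidalClosed.curry
        ((R.obj M ◁ η.app X) ≫ Functor.LaxMonoidal.μ R M X ≫ R.map f) := by
  have h : MonoidalClosed.curry f ≫ η.app _ = η.app X ≫ R.map (MonoidalClosed.curry f) :=
    η.naturality _
  rw [endMap, ← MonoidalClosed.curry_natural_left]
  congr 1
  rw [← MonoidalCategory.whiskerLeft_comp_assoc, h, MonoidalCategory.whiskerLeft_comp_assoc,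
    Functor.LaxMonoidal.μ_natural_right_assoc, ← R.map_comp,
    ← MonoidalClosed.uncurry_eq, MonoidalClosed.uncurry_curry]

end Strength

/-! ### The induced module structure on `R M`. -/

section Modules

variable {C : Type u} [Category.{v} C] [MonoidalCategory C] [SymmetricCategory C]
  {O : Operad C} {A : OpAlgebra O}

/-- The `A`-module structure on `R M` obtained from that on `M` through the strength of `R`. -/
def ModStr.mapStrength {M : C} (s : ModStr A M) (R : C ⥤ C) [R.LaxMonoidal] (η : 𝟭 C ⟶ R)
    (hη_tensor : ∀ X Y : C,
      (η.app X ⊗ₘ η.app Y) ≫ Functor.LaxMonoidal.μ R X Y = η.app (X ⊗ Y))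
    (hη_unit : η.app (𝟙_ C) = Functor.LaxMonoidal.ε R) : ModStr A (R.obj M) where
  act n := strength R η (opr A n) M ≫ R.map (s.act n)
  assoc {n} m q := by
    -- `strength_tensor` solved for the inverse associators, the direction in which the
    -- associativity axiom is stated.
    have h1 : (α_ (opr₂ A m) (opr A q) (R.obj M)).inv ≫ strength R η (opr₂ A m ⊗ opr A q) M =
        ((opr₂ A m ◁ strength R η (opr A q) M) ≫ strength R η (opr₂ A m) (opr A q ⊗ M)) ≫
          R.map (α_ _ _ _).inv := by
      rw [Iso.inv_comp_eq, ← Category.assoc, ← strength_tensor R η hη_tensor, Category.assoc,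
        ← R.map_comp, Iso.hom_inv_id, R.map_id, Category.comp_id]
    have h2 : (α_ (opr₂ A m) (opr A q) M).hom ≫ (evalInner A m ⊗ₘ s.act q) ≫ s.act n =
        (collapse A m q ▷ M) ≫ s.act (tot m + q) := by
      rw [s.assoc, Iso.hom_inv_id_assoc]
    -- The composed action is pulled inside `R`, replaced there by the iterated action on `M`, and
    -- the strength is split in two; naturality in both variables then matches the other side.
    rw [← Category.assoc (collapse A m q ▷ _), strength_natural_left, Category.assoc,
      ← R.map_comp, ← h2, ← Category.assoc (α_ _ _ _).inv, h1]
    simp only [Category.assoc, ← R.map_comp, Iso.inv_hom_id_assoc]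
    rw [tensorHom_def', tensorHom_def', MonoidalCategory.whiskerLeft_comp]
    simp only [Category.assoc, R.map_comp]
    rw [← Category.assoc (evalInner A m ▷ _), strength_natural_left, Category.assoc,
      ← Category.assoc (opr₂ A m ◁ R.map _), strength_natural_right, Category.assoc]
  equivariant {n} σ := by
    rw [← Category.assoc, strength_natural_left, Category.assoc, ← R.map_comp, s.equivariant]
  unital := by
    rw [← Category.assoc (oprUnit A ▷ _), strength_natural_left, Category.assoc, ← R.map_comp,
      Iso.inv_comp_eq, Category.comp_id, ← strength_unit R η hη_unit]
    -- What remains inside `R` is the unit axiom of `M`.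
    congr 2
    rw [← Iso.inv_comp_eq_id, s.unital]

theorem isModHom_map {M N : C} (s : ModStr A M) (t : ModStr A N) (f : M ⟶ N)
    (hf : IsModHom s t f) (R : C ⥤ C) [R.LaxMonoidal] (η : 𝟭 C ⟶ R)
    (h₁ : ∀ X Y : C, (η.app X ⊗ₘ η.app Y) ≫ Functor.LaxMonoidal.μ R X Y = η.app (X ⊗ Y))
    (h₂ : η.app (𝟙_ C) = Functor.LaxMonoidal.ε R) :
    IsModHom (s.mapStrength R η h₁ h₂) (t.mapStrength R η h₁ h₂) (R.map f) := by
  intro n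
  simp only [ModStr.mapStrength]
  rw [Category.assoc, ← R.map_comp, hf n, R.map_comp, ← Category.assoc (_ ◁ _),
    strength_natural_right, Category.assoc]

theorem isModHom_app {M : C} (s : ModStr A M) (R : C ⥤ C) [R.LaxMonoidal] (η : 𝟭 C ⟶ R)
    (h₁ : ∀ X Y : C, (η.app X ⊗ₘ η.app Y) ≫ Functor.LaxMonoidal.μ R X Y = η.app (X ⊗ Y))
    (h₂ : η.app (𝟙_ C) = Functor.LaxMonoidal.ε R) :
    IsModHom s (s.mapStrength R η h₁ h₂) (η.app M) := by
  intro n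
  have h := app_strength R η h₁ (opr A n) M
  simp only [ModStr.mapStrength]
  rw [← Category.assoc]
  erw [h]
  exact η.naturality (s.act n)

@[ext]
theorem ModStr.ext' {M : C} {s t : ModStr A M} (h : ∀ n, s.act n = t.act n) : s = t := by
  obtain ⟨a, _, _, _⟩ := s
  obtain ⟨b, _, _, _⟩ := t
  obtain rfl : a = b := funext h
  rfl

/-! ### Comparison with the enveloping algebra, and uniqueness. -/

/-- An `A`-module structure is determined by its morphism out of the enveloping algebra. -/
theorem ModStr.envMap_injective [HasColimits C] [MonoidalClosed C] (M : C) :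
    Function.Injective (ModStr.envMap : ModStr A M → (envAlg A ⟶ (ihom M).obj M)) := by
  intro s t h
  apply ModStr.ext'
  intro n
  have h1 : s.curryAct n = t.curryAct n := by
    rw [← s.toEnvAlg_map, ← t.toEnvAlg_map, h]
  have h2 := MonoidalClosed.curry_injective h1
  -- The cancelled morphism is the braiding used in `curryAct`.
  exact (cancel_epi _).1 h2

theorem envAlg_hom_ext [HasColimits C] {Y : C} {f g : envAlg A ⟶ Y}
    (h : ∀ n, toEnvAlg A n ≫ f = toEnvAlg A n ≫ g) : f = g := by
  apply coequalizer.hom_ext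
  apply Sigma.hom_ext
  intro n
  apply coequalizer.hom_ext
  simpa only [toEnvAlg, toTensorAlg, Category.assoc] using h n

/-- The strength applies `η` to the left factor, while `endMap` applies it to the right one,
following the convention for `ihom`. The two agree because `R` is braided, which is the one place
where the symmetry of `R` enters. -/
theorem ModStr.mapStrength_envMap [HasColimits C] [MonoidalClosed C] {M : C} (s : ModStr A M)
    (R : C ⥤ C) [R.LaxBraided] (η : 𝟭 C ⟶ R)
    (h₁ : ∀ X Y : C, (η.app X ⊗ₘ η.app Y) ≫ Functor.LaxMonoidal.μ R X Y = η.app (X ⊗ Y))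
    (h₂ : η.app (𝟙_ C) = Functor.LaxMonoidal.ε R) :
    (s.mapStrength R η h₁ h₂).envMap = s.envMap ≫ endMap R η M := by
  apply envAlg_hom_ext
  intro n
  rw [ModStr.toEnvAlg_map, ← Category.assoc, ModStr.toEnvAlg_map, ModStr.curryAct,
    ModStr.curryAct, curry_endMap]
  congr 1
  simp only [ModStr.mapStrength, strength, Category.assoc, R.map_comp]
  rw [Functor.LaxBraided.braided_assoc]
  exact (BraidedCategory.braiding_naturality_right_assoc _ _ _).symm

/-- Weak equivalences and fibrations are detected on underlying objects, so only the terminal module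
needs care. -/
theorem isFibrantReplacement_liftFunctor [ModelCategory C] {R : C ⥤ C} {η : 𝟭 C ⟶ R}
    (hR : IsFibrantReplacement (weakEquivalences C) (fibrations C) R η)
    (s : ∀ M : AMod A, ModStr A (R.obj M.X))
    (hs : ∀ (M N : AMod A) (f : M ⟶ N), IsModHom (s M) (s N) (R.map f.hom))
    (hη : ∀ M : AMod A, IsModHom M.str (s M) (η.app M.X)) :
    IsFibrantReplacement (modWeakEquivalences A) (modFibrations A)
      (liftFunctor R s hs) (liftNatTrans η s hs hη) where
  weakEquivalence M := hR.weakEquivalence M.X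
  fibrant M := by
    have hT : IsTerminal (terminalMod A) :=
      IsTerminal.ofUniqueHom
        (fun M => (⟨terminal.from M.X, fun _ =>
          Subsingleton.elim (α := (_ ⟶ ⊤_ C)) _ _⟩ : AMod.Hom M (terminalMod A)))
        (fun _ _ => AMod.Hom.ext (Subsingleton.elim (α := (_ ⟶ ⊤_ C)) _ _))
    -- The chosen terminal module need not have `⊤_ C` as its underlying object; it is only
    -- isomorphic to `terminalMod A`, which suffices since fibrations are stable under isomorphism.
    let e : ⊤_ (AMod A) ≅ terminalMod A := terminalIsTerminal.uniqueUpToIso hT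
    change fibrations C ((forgetMod A).map (terminal.from ((liftFunctor R s hs).obj M)))
    rw [← MorphismProperty.cancel_right_of_respectsIso (fibrations C) _ ((forgetMod A).map e.hom)]
    have h : (forgetMod A).map (terminal.from ((liftFunctor R s hs).obj M)) ≫
        (forgetMod A).map e.hom = terminal.from (R.obj M.X) :=
      Subsingleton.elim (α := (R.obj M.X ⟶ ⊤_ C)) _ _
    exact h ▸ hR.fibrant M.X

end Modules

end OperadModules

end

open OperadModules in
theorem mainTheorem12 {C : Type u} [Category.{v} C] [MonoidalCategory C] [SymmetricCategory C]
    [MonoidalClosed C] [HasColimits C] [ModelCategory C]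
    (R : C ⥤ C) [R.LaxBraided] (η : 𝟭 C ⟶ R)
    (hR : IsFibrantReplacement (weakEquivalences C) (fibrations C) R η)
    (hη_tensor : ∀ X Y : C,
      (η.app X ⊗ₘ η.app Y) ≫ Functor.LaxMonoidal.μ R X Y = η.app (X ⊗ Y))
    (hη_unit : η.app (𝟙_ C) = Functor.LaxMonoidal.ε R)
    (O : Operad C) (A : OpAlgebra O) :
    ∃ (s : ∀ M : AMod A, ModStr A (R.obj M.X))
      (hs : ∀ (M N : AMod A) (f : M ⟶ N), IsModHom (s M) (s N) (R.map f.hom))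
      (hη : ∀ M : AMod A, IsModHom M.str (s M) (η.app M.X)),
      (∀ M : AMod A, (s M).envMap = M.str.envMap ≫ endMap R η M.X) ∧
      (∀ (M : AMod A) (t : ModStr A (R.obj M.X)),
        t.envMap = M.str.envMap ≫ endMap R η M.X → t = s M) ∧
      IsFibrantReplacement (modWeakEquivalences A) (modFibrations A)
        (liftFunctor R s hs) (liftNatTrans η s hs hη) ∧
      (∀ [ModelCategory (AMod A)],
        weakEquivalences (AMod A) = modWeakEquivalences A →
        fibrations (AMod A) = modFibrations A →
        IsFibrantReplacement (weakEquivalences (AMod A)) (fibrations (AMod A))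
          (liftFunctor R s hs) (liftNatTrans η s hs hη)) := by
  refine ⟨fun M => M.str.mapStrength R η hη_tensor hη_unit,
    fun M N f => isModHom_map _ _ _ f.isModHom R η hη_tensor hη_unit,
    fun M => isModHom_app _ R η hη_tensor hη_unit,
    fun M => M.str.mapStrength_envMap R η hη_tensor hη_unit,
    fun M t ht => ModStr.envMap_injective _
      (ht.trans (M.str.mapStrength_envMap R η hη_tensor hη_unit).symm),
    isFibrantReplacement_liftFunctor hR _ _ _, ?_⟩
  intro _ hW hF
  rw [hW, hF]
  exact isFibrantReplacement_liftFunctor hR _ _ _
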